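/- A hypergraph is a finite vertex set $V$ together with a finite multiset of edges, each a subset of $V$ with at least two elements. It is labeled if it has vertex set $[n]$ and, for each $i\ge 2$, its $\lambda_i$ edges of size $i$ are labeled by $[\lambda_i]$. A walk is a sequence $v_0,e_1,v_1,\dots,e_m,v_m$ with $v_{i-1},v_i\in e_i$; it is a path if all $v_i$ and all $e_i$ are distinct, and a cycle if $m\ge 2$, all $e_i$ are distinct, and all $v_i$ are distinct except that $v_0=v_m$. A hypergraph with at least one vertex is connected if any two vertices are joined by a path; a hypertree is a connected hypergraph with no cycles. For $\lambda=(\lambda_2,\lambda_3,\dots)$ with finitely many nonzero entries write $u^\lambda=\prod_i u_i^{\lambda_i}$ and $\lambda!=\prod_i\lambda_i!$, and let the magnitude of $u^\lambda$ be $\sum_i (i-1)\lambda_i$. Let $$C(t;u_2,u_3,\dots)=\sum_{n\ge1}\frac{t^n}{n!}C_n,\qquad C_n=\sum_\lambda c_{n,\lambda}\frac{u^\lambda}{\lambda!},$$ where $c_{n,\lambda}$ is the number of connected labeled hypergraphs on $[n]$ with $\lambda_i$ edges of size $i$ for each $i$. Let $T_n$ consist of all terms of magnitude $n-1$ in $C_n$,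 and let $T=\sum_{n\ge1}\frac{t^n}{n!}T_n$. Then: 1. Every term of $C_n$ has magnitude at least $n-1$ (so $T$ consists of the leading terms of $C$), and $T$ is the exponential generating function of labeled hypertrees: the coefficient of $\frac{t^n}{n!}\frac{u^\lambda}{\lambda!}$ in $T$ is the number of labeled hypertrees on $[n]$ with $\lambda_i$ edges of size $i$ for each $i$. 2. $\displaystyle \frac{\partial T}{\partial u_2}=\frac12\Bigl(t\frac{\partial T}{\partial t}\Bigr)^2$, and $\displaystyle \frac{\partial T}{\partial u_j}=\frac1j\Bigl(t\frac{\partial T}{\partial t}\Bigr)\frac{\partial T}{\partial u_{j-1}}$ for all $j\ge3$. 3. $\displaystyle \frac{\partial T}{\partial u_j}=\frac1{j!}\Bigl(t\frac{\partial T}{\partial t}\Bigr)^j$ for all $j\ge2$. 4. For all $j\ge 2$, $n$ and $\lambda$, the coefficient of $\frac{t^n}{n!}\frac{u^\lambda}{\lambda!}$ on the left side of 3 is the number of hypertrees on $[n]$ rooted at an unlabeled edge of size $j$ and having, besides the root edge, $\lambda_i$ labeled edges of size $i$ for each $i$. The same coefficient on the right side is the number of sets of $j$ vertex-rooted hypertrees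 whose vertex sets partition $[n]$ and whose edges, taken together, are $\lambda_i$ labeled edges of size $i$ for each $i$. Removing the root edge and rooting each resulting component at its vertex in that edge is a bijection from the former objects to the latter. -/

import Mathlib

open scoped Nat

namespace HypertreeEGF

/-- A hypergraph on the vertex set `V` whose edges are labeled by the elements of `E`. Every edge
is a set of at least two vertices; differently labeled edges may be equal as sets, so multiple
edges are allowed, loops are not, and a vertex may belong to no edge. -/
@[ext]
structure LabeledHypergraph (V E : Type) where
  edge : E → Finset V
  two_le_card : ∀ e, 2 ≤ (edge e).card

namespace LabeledHypergraph

variable {V E : Type}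

/-- `v 0, e 0, v 1, e 1, …, e (m - 1), v m` is a walk: consecutive vertices both lie in the edge
between them. -/
def IsWalk (H : LabeledHypergraph V E) {m : ℕ} (v : Fin (m + 1) → V) (e : Fin m → E) : Prop :=
  ∀ i : Fin m, v i.castSucc ∈ H.edge (e i) ∧ v i.succ ∈ H.edge (e i)

/-- A path is a walk whose vertices are distinct and whose edges are distinct. -/
def IsPath (H : LabeledHypergraph V E) {m : ℕ} (v : Fin (m + 1) → V) (e : Fin m → E) : Prop :=
  H.IsWalk v e ∧ Function.Injective v ∧ Function.Injective e

/-- A cycle is a walk with at least two edges whose edges are distinct and whose vertices are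
distinct except that the first and the last one coincide. -/
def IsCycle (H : LabeledHypergraph V E) {m : ℕ} (v : Fin (m + 1) → V) (e : Fin m → E) : Prop :=
  H.IsWalk v e ∧ 2 ≤ m ∧ Function.Injective e ∧
    Function.Injective (fun i : Fin m => v i.castSucc) ∧ v 0 = v (Fin.last m)

/-- Any two vertices are joined by a path. The hypergraph without vertices is not counted as
connected. -/
def IsConnected (H : LabeledHypergraph V E) : Prop :=
  Nonempty V ∧ ∀ x y : V, ∃ (m : ℕ) (v : Fin (m + 1) → V) (e : Fin m → E),
    H.IsPath v e ∧ v 0 = x ∧ v (Fin.last m) = y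

/-- A hypertree is a connected hypergraph with no cycles. -/
def IsHypertree (H : LabeledHypergraph V E) : Prop :=
  H.IsConnected ∧ ∀ (m : ℕ) (v : Fin (m + 1) → V) (e : Fin m → E), ¬ H.IsCycle v e

end LabeledHypergraph

/-- The possible edge sizes `2, 3, 4, …`. -/
abbrev EdgeSize : Type := {i : ℕ // 2 ≤ i}

/-- The edge labels when there are `l i` edges of size `i`: these are labeled by `Fin (l i)`
for each `i` separately. -/
abbrev EdgeLabel (l : EdgeSize →₀ ℕ) : Type := Σ i : EdgeSize, Fin (l i)

/-- The size of the edge with a given label. -/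
def EdgeLabel.size {l : EdgeSize →₀ ℕ} (e : EdgeLabel l) : ℕ := e.1.1

instance (l : EdgeSize →₀ ℕ) : Finite (EdgeLabel l) := by
  refine Finite.of_injective (β := Σ i : l.support, Fin (l i))
    (fun e => ⟨⟨e.1, by simp; have := e.2.pos; omega⟩, e.2⟩) ?_
  rintro ⟨a, b⟩ ⟨c, d⟩ h
  simp at h
  obtain ⟨rfl, h⟩ := h
  simp_all

instance {V E : Type} [Finite V] [Finite E] : Finite (LabeledHypergraph V E) :=
  Finite.of_injective _ fun _ _ h => LabeledHypergraph.ext h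

/-- Connected labeled hypergraphs with `n` labeled vertices and `l i` labeled `i`-edges. -/
def ConnectedHypergraphs (n : ℕ) (l : EdgeSize →₀ ℕ) :
    Set (LabeledHypergraph (Fin n) (EdgeLabel l)) :=
  {H | H.IsConnected ∧ ∀ e, (H.edge e).card = e.size}

/-- Labeled hypertrees with `n` labeled vertices and `l i` labeled `i`-edges. -/
def Hypertrees (n : ℕ) (l : EdgeSize →₀ ℕ) :
    Set (LabeledHypergraph (Fin n) (EdgeLabel l)) :=
  {H | H.IsHypertree ∧ ∀ e, (H.edge e).card = e.size}

/-- Formal power series over `ℚ` in `t` (the index `none`) and `u₂, u₃, …` (the indices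
`some i`). -/
abbrev Series : Type := MvPowerSeries (Option EdgeSize) ℚ

/-- The index of the variable `t`. -/
abbrev tVar : Option EdgeSize := none

/-- The index of the variable `u_j`. -/
abbrev uVar (j : ℕ) (hj : 2 ≤ j) : Option EdgeSize := some ⟨j, hj⟩

/-- The product `λ! = λ₂! λ₃! λ₄! ⋯`. -/
def multiFactorial (l : EdgeSize →₀ ℕ) : ℕ := l.prod fun _ k => k !

/-- The coefficient of `(t ^ n / n!) (u ^ λ / λ!)` in `F`. -/
noncomputable def egfCoeff (F : Series) (n : ℕ) (l : EdgeSize →₀ ℕ) : ℚ :=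
  n ! * multiFactorial l * MvPowerSeries.coeff (Finsupp.optionElim n l) F

/-- The magnitude `∑ (i - 1) λ_i` of `u ^ λ`. -/
def magnitude (l : EdgeSize →₀ ℕ) : ℕ := l.sum fun i k => (i.1 - 1) * k

/-- The exponential generating function of connected labeled hypergraphs,
`C = ∑ (number of connected hypergraphs) (t ^ n / n!) (u ^ λ / λ!)`. -/
noncomputable def C : Series := fun m =>
  ((ConnectedHypergraphs (m none) m.some).ncard : ℚ) / ((m none)! * multiFactorial m.some)

open scoped Classical in
/-- The series `T = ∑_{n ≥ 1} (t ^ n / n!) T_n`, where `T_n` consists of all the terms of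
magnitude `n - 1` in the coefficient `C_n` of `t ^ n / n!` in `C`. -/
noncomputable def T : Series := fun m =>
  if magnitude m.some + 1 = m none then MvPowerSeries.coeff m C else 0

/-- The operator `t ∂/∂t`. -/
noncomputable def tDeriv (F : Series) : Series :=
  MvPowerSeries.X tVar * MvPowerSeries.pderiv ℚ tVar F

/-- A hypertree that is rooted at an unlabeled `j`-edge (the edge `none`), on `n` labeled vertices
and with `l i` further labeled `i`-edges. -/
def EdgeRootedHypertree (n : ℕ) (l : EdgeSize →₀ ℕ) (j : ℕ) : Type :=
  {H : LabeledHypergraph (Fin n) (Option (EdgeLabel l)) //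
    H.IsHypertree ∧ (H.edge none).card = j ∧ ∀ e, (H.edge (some e)).card = e.size}

/-- A vertex-rooted hypertree whose vertices form a subset of `V` and whose edge labels form a
subset of `E`. -/
structure VertexRootedHypertree (V E : Type) where
  verts : Set V
  labels : Set E
  graph : LabeledHypergraph verts labels
  isHypertree : graph.IsHypertree
  root : verts

/-- The edge with label `e`, as a subset of the ambient vertex set. -/
def VertexRootedHypertree.edge {V E : Type} (P : VertexRootedHypertree V E) (e : P.labels) :
    Finset V :=
  (P.graph.edge e).map (Function.Embedding.subtype _)

/-- A set of `j` vertex-rooted hypertrees that together have `n` labeled vertices and `l i` labeled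
`i`-edges: every vertex and every edge label is used in exactly one of the hypertrees. -/
def VertexRootedHypertreeSet (n : ℕ) (l : EdgeSize →₀ ℕ) (j : ℕ) : Type :=
  {S : Finset (VertexRootedHypertree (Fin n) (EdgeLabel l)) //
    S.card = j ∧
    (∀ v, ∃! P, P ∈ S ∧ v ∈ P.verts) ∧
    (∀ e, ∃! P, P ∈ S ∧ e ∈ P.labels) ∧
    ∀ P ∈ S, ∀ e : P.labels, (P.edge e).card = e.1.size}

/-- `S` arises from `H` by removing the root edge: the roots in `S` are the vertices of the root
edge, and all other edges stay the same. -/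
def IsRemovalOfRootEdge {n : ℕ} {l : EdgeSize →₀ ℕ} {j : ℕ}
    (H : EdgeRootedHypertree n l j) (S : VertexRootedHypertreeSet n l j) : Prop :=
  (∀ v, v ∈ H.1.edge none ↔ ∃ P ∈ S.1, (P.root : Fin n) = v) ∧
    ∀ P ∈ S.1, ∀ e : P.labels, P.edge e = H.1.edge (some e.1)

end HypertreeEGF

open HypertreeEGF

/-! Everything rests on the bipartite incidence graph of vertices against edges. A connected
hypergraph has a connected incidence graph, and hypergraph cycles correspond to cycles there
(`incidenceGraph_isAcyclic_iff`). That graph has `|V| + |E|` vertices and `∑ |e|` edges, so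
connectedness forces `|V| ≤ ∑ (|e| - 1) + 1`, with equality exactly for trees
(`isHypertree_iff_card`). As `∑ (|e| - 1)` is the magnitude, the terms of magnitude `n - 1` count
hypertrees.

For the differential equation, compare exponential coefficients. Differentiating in `u_j` shifts an
index, which adds one distinguished edge of size `j`. The operator `t ∂/∂t` chooses a root vertex, a
`j`-th power distributes all labels among `j` rooted trees (`expCoeff_prod`), and dividing by `j!`
forgets the order of the trees. Deleting the root edge matches the two kinds of objects
(`exists_equiv_isRemovalOfRootEdge`): acyclicity puts the vertices of the root edge into distinct
components, and gluing trees along a new edge preserves the vertex count that characterises trees.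
The two recursions then follow from `j! = j * (j - 1)!`. -/

namespace HypertreeEGF

/-! ### Coefficients of exponential generating functions -/

section ExponentialCoefficients

variable {σ : Type}

/-- The coefficient of `∏ xᵢ ^ mᵢ / mᵢ!` in `F`. -/
noncomputable def expCoeff (m : σ →₀ ℕ) (F : MvPowerSeries σ ℚ) : ℚ :=
  ((m.prod fun _ k => k ! : ℕ) : ℚ) * MvPowerSeries.coeff m F

theorem prod_factorial_add_single (m : σ →₀ ℕ) (s : σ) :
    ((m + Finsupp.single s 1).prod fun _ k => k !) = (m s + 1) * m.prod fun _ k => k ! := by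
  classical
  rw [← Finsupp.mul_prod_erase' (m + Finsupp.single s 1) s _ (by simp),
    ← Finsupp.mul_prod_erase' m s _ (by simp)]
  simp [Finsupp.erase_add, Nat.factorial_succ, mul_assoc]

/-- The factorial normalisation absorbs the factor `m s + 1` that differentiation produces, leaving
a pure index shift. -/
theorem expCoeff_add_single (m : σ →₀ ℕ) (s : σ) (F : MvPowerSeries σ ℚ) :
    expCoeff (m + Finsupp.single s 1) F = expCoeff m (MvPowerSeries.pderiv ℚ s F) := by
  rw [expCoeff, expCoeff, prod_factorial_add_single, MvPowerSeries.coeff_pderiv]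
  push_cast
  ring

theorem expCoeff_sum {ι : Type} (s : Finset ι) (m : σ →₀ ℕ) (F : ι → MvPowerSeries σ ℚ) :
    expCoeff m (∑ i ∈ s, F i) = ∑ i ∈ s, expCoeff m (F i) := by
  simp [expCoeff, Finset.mul_sum]

theorem expCoeff_smul (m : σ →₀ ℕ) (a : ℚ) (F : MvPowerSeries σ ℚ) :
    expCoeff m (a • F) = a * expCoeff m F := by
  simp [expCoeff]
  ring

/-- The Leibniz rule in a form where each summand is again a product over all of `ι`, so that an
induction hypothesis about such products applies to it. -/
theorem derivation_prod_eq_sum_update {R A ι : Type} [CommRing R] [CommRing A] [Algebra R A]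
    [Fintype ι] [DecidableEq ι] (D : Derivation R A A) (F : ι → A) :
    D (∏ i, F i) = ∑ k, ∏ i, Function.update F k (D (F k)) i := by
  have key : ∀ s : Finset ι,
      D (∏ i ∈ s, F i) = ∑ k ∈ s, ∏ i ∈ s, Function.update F k (D (F k)) i := by
    intro s
    induction s using Finset.induction_on with
    | empty => simp
    | insert a s ha ih =>
      rw [Finset.prod_insert ha, Derivation.leibniz, ih, Finset.sum_insert ha,
        Finset.prod_insert ha, add_comm, smul_eq_mul, smul_eq_mul, Finset.mul_sum]
      congr 1
      · rw [Function.update_self, mul_comm]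
        congr 1
        exact Finset.prod_congr rfl fun i hi => by
          rw [Function.update_of_ne (ne_of_mem_of_not_mem hi ha)]
      · refine Finset.sum_congr rfl fun k hk => ?_
        rw [Finset.prod_insert ha, Function.update_of_ne (ne_of_mem_of_not_mem hk ha).symm]
  exact key _

/-- The number of elements of each colour. -/
noncomputable def colorCount {α : Type} [Fintype α] (c : α → σ) : σ →₀ ℕ :=
  ∑ a, Finsupp.single (c a) 1

/-- The number of elements of each colour in the fibre of `h` over `i`. -/
noncomputable def fiberCount {α ι : Type} [Fintype α] [DecidableEq ι] (c : α → σ) (h : α → ι)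
    (i : ι) : σ →₀ ℕ :=
  ∑ a, if h a = i then Finsupp.single (c a) 1 else 0

theorem fiberCount_eq_colorCount {α ι : Type} [Fintype α] [DecidableEq ι] (c : α → σ) (h : α → ι)
    (i : ι) [Fintype {a | h a = i}] :
    fiberCount c h i = colorCount fun a : {a | h a = i} => c a := by
  rw [fiberCount, colorCount, ← Finset.sum_filter]
  exact (Finset.sum_subtype _ (by simp) _)

/-- The coefficients of a product of exponential generating functions are sums over all
distributions of the labels among the factors. -/
theorem expCoeff_prod {ι : Type} [Fintype ι] [DecidableEq ι] (α : Type) [Fintype α]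
    [DecidableEq α] (c : α → σ) (F : ι → MvPowerSeries σ ℚ) :
    expCoeff (colorCount c) (∏ i, F i) = ∑ h : α → ι, ∏ i, expCoeff (fiberCount c h i) (F i) := by
  suffices H : ∀ (c : α → σ) (F : ι → MvPowerSeries σ ℚ), expCoeff (colorCount c) (∏ i, F i) =
      ∑ h : α → ι, ∏ i, expCoeff (fiberCount c h i) (F i) from H c F
  refine Fintype.induction_empty_option
    (P := fun α _ => ∀ [DecidableEq α] (c : α → σ) (F : ι → MvPowerSeries σ ℚ),
      expCoeff (colorCount c) (∏ i, F i) =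
        ∑ h : α → ι, ∏ i, expCoeff (fiberCount c h i) (F i)) ?_ ?_ ?_ α
  · intro α β _ e ih _ c F
    let _ := Fintype.ofEquiv β e.symm
    classical
    have h1 : colorCount c = colorCount (c ∘ e) := (Equiv.sum_comp e _).symm
    rw [h1, ih]
    refine Fintype.sum_equiv (Equiv.arrowCongr e (Equiv.refl ι)) _ _ fun h => ?_
    refine Finset.prod_congr rfl fun i _ => ?_
    congr 1
    rw [fiberCount, fiberCount, ← Equiv.sum_comp e]
    simp
  · intro _ c F
    simp [colorCount, fiberCount, expCoeff, MvPowerSeries.coeff_zero_eq_constantCoeff]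
  · intro α _ ih _ c F
    classical
    have h1 : colorCount c = colorCount (fun a => c (some a)) + Finsupp.single (c none) 1 := by
      rw [colorCount, Fintype.sum_option, add_comm, colorCount]
    -- Adding one label of colour `c none` is differentiation in that variable; the summand `k` of
    -- the Leibniz rule says that the new label goes to the factor `k`.
    rw [h1, expCoeff_add_single, derivation_prod_eq_sum_update, expCoeff_sum]
    simp_rw [ih]
    rw [← Fintype.sum_prod_type']
    refine Fintype.sum_equiv (Equiv.piOptionEquivProd (β := fun _ => ι)).symm _ _ ?_
    rintro ⟨k, h⟩
    refine Finset.prod_congr rfl fun i _ => ?_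
    have h2 : fiberCount c ((Equiv.piOptionEquivProd (β := fun _ => ι)).symm (k, h)) i =
        fiberCount (fun a => c (some a)) h i + if k = i then Finsupp.single (c none) 1 else 0 := by
      rw [fiberCount, Fintype.sum_option, add_comm, fiberCount]
      rfl
    rw [h2]
    split_ifs with hk
    · subst hk
      rw [Function.update_self, expCoeff_add_single]
    · rw [Function.update_of_ne (Ne.symm hk), add_zero]

end ExponentialCoefficients

/-! ### Coefficients of `C`, `T` and their derivatives -/

theorem egfCoeff_eq_expCoeff (F : Series) (n : ℕ) (l : EdgeSize →₀ ℕ) :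
    egfCoeff F n l = expCoeff (Finsupp.optionElim n l) F := by
  have : (Finsupp.optionElim n l).prod (fun _ k => k !) = n ! * multiFactorial l := by
    classical
    rw [← Finsupp.mul_prod_erase' _ none _ (by simp), Finsupp.optionElim_apply_none]
    congr 1
    have h : (Finsupp.optionElim n l).erase none = l.embDomain Function.Embedding.some := by
      ext (_ | s)
      · simp
      · rw [Finsupp.erase_ne (by simp), Finsupp.optionElim_apply_some]
        exact (Finsupp.embDomain_apply_self Function.Embedding.some l s).symm
    rw [h, Finsupp.prod_embDomain, multiFactorial]
  rw [egfCoeff, expCoeff, this]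
  push_cast
  ring

theorem egfCoeff_smul (a : ℚ) (F : Series) (n : ℕ) (l : EdgeSize →₀ ℕ) :
    egfCoeff (a • F) n l = a * egfCoeff F n l := by
  rw [egfCoeff_eq_expCoeff, egfCoeff_eq_expCoeff, expCoeff_smul]

theorem multiFactorial_ne_zero (l : EdgeSize →₀ ℕ) : multiFactorial l ≠ 0 :=
  Finset.prod_ne_zero_iff.2 fun _ _ => Nat.factorial_ne_zero _

theorem series_ext {F G : Series} (h : ∀ n l, egfCoeff F n l = egfCoeff G n l) : F = G := by
  ext m
  have h1 := h (m none) m.some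
  rw [egfCoeff, egfCoeff, Finsupp.optionElim_some] at h1
  refine mul_left_cancel₀ ?_ h1
  exact mul_ne_zero (Nat.cast_ne_zero.2 (Nat.factorial_ne_zero _))
    (Nat.cast_ne_zero.2 (multiFactorial_ne_zero _))

theorem egfCoeff_tDeriv (F : Series) (n : ℕ) (l : EdgeSize →₀ ℕ) :
    egfCoeff (tDeriv F) n l = n * egfCoeff F n l := by
  rw [egfCoeff, egfCoeff, tDeriv]
  have : MvPowerSeries.coeff (Finsupp.optionElim n l)
      (MvPowerSeries.X tVar * MvPowerSeries.pderiv ℚ tVar F) =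
      n * MvPowerSeries.coeff (Finsupp.optionElim n l) F := by
    rw [MvPowerSeries.X, MvPowerSeries.coeff_monomial_mul]
    split_ifs with h
    · rw [MvPowerSeries.coeff_pderiv, tsub_add_cancel_of_le h, one_mul, mul_comm]
      congr 1
      have := h none
      simp only [Finsupp.single_eq_same, Finsupp.optionElim_apply_none] at this
      simp [Nat.cast_sub this]
    -- The monomial fails to be divisible by `t` only for `n = 0`, where both sides vanish.
    · have : n = 0 := by
        by_contra hn
        exact h (Finsupp.single_le_iff.2 (by rw [Finsupp.optionElim_apply_none]; omega))
      simp [this]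
  rw [this]
  ring

theorem egfCoeff_C (n : ℕ) (l : EdgeSize →₀ ℕ) :
    egfCoeff C n l = (ConnectedHypergraphs n l).ncard := by
  have h : MvPowerSeries.coeff (Finsupp.optionElim n l) C =
      C (Finsupp.optionElim n l) := rfl
  have h1 : (n ! : ℚ) ≠ 0 := Nat.cast_ne_zero.2 (Nat.factorial_ne_zero _)
  have h2 : (multiFactorial l : ℚ) ≠ 0 := Nat.cast_ne_zero.2 (multiFactorial_ne_zero _)
  rw [egfCoeff, h, C, Finsupp.some_optionElim, Finsupp.optionElim_apply_none]
  field_simp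

theorem egfCoeff_T (n : ℕ) (l : EdgeSize →₀ ℕ) :
    egfCoeff T n l =
      if magnitude l + 1 = n then ((ConnectedHypergraphs n l).ncard : ℚ) else 0 := by
  have h : MvPowerSeries.coeff (Finsupp.optionElim n l) T =
      T (Finsupp.optionElim n l) := rfl
  rw [egfCoeff, h, T, Finsupp.some_optionElim, Finsupp.optionElim_apply_none]
  split_ifs
  · exact egfCoeff_C n l
  · simp

theorem egfCoeff_pderiv_uVar (F : Series) (j : ℕ) (hj : 2 ≤ j) (n : ℕ) (l : EdgeSize →₀ ℕ) :
    egfCoeff (MvPowerSeries.pderiv ℚ (uVar j hj) F) n l =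
      egfCoeff F n (l + Finsupp.single ⟨j, hj⟩ 1) := by
  rw [egfCoeff_eq_expCoeff, egfCoeff_eq_expCoeff, ← expCoeff_add_single]
  congr 1
  ext (_ | s)
  · simp
  · simp [Finsupp.single_apply]

/-! ### Hypertrees and their incidence graphs -/

namespace LabeledHypergraph

variable {V E : Type}

/-- Two vertices are adjacent if some edge contains both of them. -/
def Adjacent (H : LabeledHypergraph V E) (x y : V) : Prop :=
  ∃ e, x ∈ H.edge e ∧ y ∈ H.edge e

/-- The equivalence relation generated by adjacency. -/
def Linked (H : LabeledHypergraph V E) : V → V → Prop :=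
  Relation.ReflTransGen H.Adjacent

/-- The bipartite graph of incidences between vertices and edges. -/
def incidenceGraph (H : LabeledHypergraph V E) : SimpleGraph (V ⊕ E) where
  Adj
    | .inl v, .inr e => v ∈ H.edge e
    | .inr e, .inl v => v ∈ H.edge e
    | _, _ => False
  symm := ⟨by rintro (v | e) (w | f) h <;> exact h⟩
  loopless := ⟨by rintro (v | e) h <;> exact h⟩

variable (H : LabeledHypergraph V E)

theorem edge_nonempty (e : E) : (H.edge e).Nonempty :=
  Finset.card_pos.1 (lt_of_lt_of_le two_pos (H.two_le_card e))

variable {H}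

theorem Linked.symm {x y : V} (h : H.Linked x y) : H.Linked y x := by
  have : Std.Symm H.Adjacent := ⟨fun _ _ ⟨e, h1, h2⟩ => ⟨e, h2, h1⟩⟩
  exact Std.Symm.symm (r := Relation.ReflTransGen H.Adjacent) _ _ h

theorem Linked.trans {x y z : V} (h : H.Linked x y) (h' : H.Linked y z) : H.Linked x z :=
  Relation.ReflTransGen.trans h h'

theorem Linked.refl (x : V) : H.Linked x x := Relation.ReflTransGen.refl

theorem linked_of_mem {e : E} {x y : V} (hx : x ∈ H.edge e) (hy : y ∈ H.edge e) :
    H.Linked x y := Relation.ReflTransGen.single ⟨e, hx, hy⟩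

theorem IsWalk.linked {m : ℕ} {v : Fin (m + 1) → V} {e : Fin m → E} (h : H.IsWalk v e)
    (i : Fin (m + 1)) : H.Linked (v 0) (v i) := by
  induction i using Fin.induction with
  | zero => exact Linked.refl _
  | succ i ih => exact ih.trans (linked_of_mem (h i).1 (h i).2)

theorem Linked.reachable {x y : V} (h : H.Linked x y) :
    H.incidenceGraph.Reachable (.inl x) (.inl y) := by
  induction h with
  | refl => exact SimpleGraph.Reachable.refl _
  | tail _ h ih =>
    obtain ⟨e, h1, h2⟩ := h
    have a1 : H.incidenceGraph.Adj (.inl _) (.inr e) := h1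
    have a2 : H.incidenceGraph.Adj (.inr e) (.inl _) := h2
    exact ih.trans (a1.reachable.trans a2.reachable)

theorem getVert_even_odd {x : V} {w : V ⊕ E} (p : H.incidenceGraph.Walk (.inl x) w) (i : ℕ) :
    (2 * i ≤ p.length → ∃ v, p.getVert (2 * i) = .inl v) ∧
      (2 * i + 1 ≤ p.length → ∃ e, p.getVert (2 * i + 1) = .inr e) := by
  have step : ∀ i, (2 * i ≤ p.length → ∃ v, p.getVert (2 * i) = .inl v) →
      (2 * i + 1 ≤ p.length → ∃ e, p.getVert (2 * i + 1) = .inr e) := by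
    intro i h hi
    obtain ⟨v, hv⟩ := h (by omega)
    have ha := p.adj_getVert_succ (i := 2 * i) (by omega)
    rw [hv] at ha
    rcases hw : p.getVert (2 * i + 1) with w | e
    · rw [hw] at ha
      exact absurd ha id
    · exact ⟨e, rfl⟩
  have main : ∀ i, 2 * i ≤ p.length → ∃ v, p.getVert (2 * i) = .inl v := by
    intro i
    induction i with
    | zero => exact fun _ => ⟨x, by simp⟩
    | succ i ih =>
      intro hi
      obtain ⟨e, he⟩ := step i ih (by omega)
      have ha := p.adj_getVert_succ (i := 2 * i + 1) (by omega)
      rw [he] at ha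
      rcases hw : p.getVert (2 * i + 1 + 1) with w | f
      · exact ⟨w, rfl⟩
      · rw [hw] at ha
        exact absurd ha id
  exact ⟨main i, step i (main i)⟩

/-- A walk of the incidence graph between two vertices of the hypergraph is a walk of the
hypergraph. -/
theorem exists_isWalk_of_walk {x y : V} (p : H.incidenceGraph.Walk (.inl x) (.inl y)) :
    ∃ (m : ℕ) (v : Fin (m + 1) → V) (e : Fin m → E), p.length = 2 * m ∧ H.IsWalk v e ∧
      (∀ i : Fin (m + 1), p.getVert (2 * i) = .inl (v i)) ∧
      ∀ i : Fin m, p.getVert (2 * i + 1) = .inr (e i) := by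
  obtain ⟨m, hm⟩ : ∃ m, p.length = 2 * m := by
    rcases Nat.even_or_odd' p.length with ⟨m, h | h⟩
    · exact ⟨m, h⟩
    · obtain ⟨e, he⟩ := (getVert_even_odd p m).2 h.ge
      rw [← h, p.getVert_length] at he
      cases he
  have h1 : ∀ i : Fin (m + 1), ∃ v, p.getVert (2 * i) = .inl v :=
    fun i => (getVert_even_odd p i).1 (by omega)
  have h2 : ∀ i : Fin m, ∃ e, p.getVert (2 * i + 1) = .inr e :=
    fun i => (getVert_even_odd p i).2 (by omega)
  choose v hv using h1
  choose e he using h2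
  refine ⟨m, v, e, hm, fun i => ⟨?_, ?_⟩, hv, he⟩
  · have ha := p.adj_getVert_succ (i := 2 * i) (by omega)
    have hv' := hv i.castSucc
    rw [Fin.val_castSucc] at hv'
    rwa [hv', he] at ha
  · have ha := p.adj_getVert_succ (i := 2 * i + 1) (by omega)
    have hv' : p.getVert (2 * i + 1 + 1) = _ := hv i.succ
    rwa [hv', he] at ha

/-- A simple path of the incidence graph repeats neither a vertex nor an edge of the hypergraph, so
its even and odd positions give both injectivity conditions. -/
theorem Linked.exists_isPath {x y : V} (h : H.Linked x y) :
    ∃ (m : ℕ) (v : Fin (m + 1) → V) (e : Fin m → E),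
      H.IsPath v e ∧ v 0 = x ∧ v (Fin.last m) = y := by
  obtain ⟨p, hp⟩ := h.reachable.exists_isPath
  obtain ⟨m, v, e, hm, hw, hv, he⟩ := exists_isWalk_of_walk p
  have inj := hp.getVert_injOn
  refine ⟨m, v, e, ⟨hw, fun i k hik => ?_, fun i k hik => ?_⟩, ?_, ?_⟩
  · have := inj (x₁ := 2 * i) (x₂ := 2 * k) (by simp; omega) (by simp; omega)
      (by rw [hv, hv, hik])
    omega
  · have := inj (x₁ := 2 * i + 1) (x₂ := 2 * k + 1) (by simp; omega) (by simp; omega)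
      (by rw [he, he, hik])
    omega
  · have := hv 0
    simpa using this.symm
  · have := hv (Fin.last m)
    rw [Fin.val_last, ← hm, p.getVert_length] at this
    exact (Sum.inl_injective this).symm

theorem isConnected_iff_linked : H.IsConnected ↔ Nonempty V ∧ ∀ x y, H.Linked x y := by
  refine and_congr_right fun _ => forall₂_congr fun x y => ⟨?_, Linked.exists_isPath⟩
  rintro ⟨m, v, e, hp, rfl, rfl⟩
  exact hp.1.linked _

theorem IsConnected.incidenceGraph_connected (h : H.IsConnected) :
    H.incidenceGraph.Connected := by
  obtain ⟨⟨x⟩, h⟩ := isConnected_iff_linked.1 h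
  refine (SimpleGraph.connected_iff_exists_forall_reachable _).2 ⟨.inl x, ?_⟩
  rintro (y | e)
  · exact (h x y).reachable
  · obtain ⟨y, hy⟩ := H.edge_nonempty e
    have a : H.incidenceGraph.Adj (.inl y) (.inr e) := hy
    exact (h x y).reachable.trans a.reachable

theorem incidenceGraph_isAcyclic_iff :
    H.incidenceGraph.IsAcyclic ↔
      ∀ (m : ℕ) (v : Fin (m + 1) → V) (e : Fin m → E), ¬ H.IsCycle v e := by
  classical
  constructor
  · rintro h m v e ⟨hw, hm, he, hv, h0⟩
    have hb := SimpleGraph.isAcyclic_iff_forall_isBridge.1 h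
      (e := s(.inl (v 0), .inr (e ⟨0, by omega⟩))) (hw ⟨0, by omega⟩).1
    rw [SimpleGraph.isBridge_iff] at hb
    set G := H.incidenceGraph.deleteEdges {s(.inl (v 0), .inr (e ⟨0, by omega⟩))} with hG
    -- With the incidence of `v 0` and `e 0` deleted, the rest of the cycle still joins `e 0` to
    -- every later `v k`. At `k = m` this is `v 0` again, so the incidence is not a bridge.
    have key : ∀ k (hk : k < m + 1), 1 ≤ k →
        G.Reachable (.inr (e ⟨0, by omega⟩)) (.inl (v ⟨k, hk⟩)) := by
      intro k hk h1
      induction k, h1 using Nat.le_induction with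
      | base =>
        apply SimpleGraph.Adj.reachable
        have h3 := (hw ⟨0, by omega⟩).2
        -- Here `2 ≤ m` is needed: for `m = 1` the vertex `v 1` would be `v 0`.
        have h2 : v ⟨1, hk⟩ ≠ v 0 := fun hc => by
          have := @hv ⟨1, by omega⟩ ⟨0, by omega⟩ hc
          simp at this
        rw [hG, SimpleGraph.deleteEdges_adj]
        refine ⟨h3, ?_⟩
        simpa using h2
      | succ k h1 ih =>
        have hk' : k < m := by omega
        have hne : e ⟨k, hk'⟩ ≠ e ⟨0, by omega⟩ := fun hc => by
          have := he hc
          simp at this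
          omega
        have a1 : G.Adj (.inl (v ⟨k, by omega⟩)) (.inr (e ⟨k, hk'⟩)) := by
          rw [hG, SimpleGraph.deleteEdges_adj]
          exact ⟨(hw ⟨k, hk'⟩).1, by simp [hne]⟩
        have a2 : G.Adj (.inr (e ⟨k, hk'⟩)) (.inl (v ⟨k + 1, hk⟩)) := by
          rw [hG, SimpleGraph.deleteEdges_adj]
          exact ⟨(hw ⟨k, hk'⟩).2, by simp [hne]⟩
        exact (ih (by omega)).trans (a1.reachable.trans a2.reachable)
    apply hb
    have := (key m (by omega) (by omega)).symm
    rw [h0]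
    exact this
  · intro h
    have main : ∀ x (c : H.incidenceGraph.Walk (.inl x) (.inl x)), ¬ c.IsCycle := by
      intro x c hc
      obtain ⟨m, v, e, hm, hw, hv, he⟩ := exists_isWalk_of_walk c
      have h3 := hc.three_le_length
      have inj := hc.getVert_injOn'
      refine h m v e ⟨hw, by omega, fun i k hik => ?_, fun i k hik => ?_, ?_⟩
      · have := inj (x₁ := 2 * i + 1) (x₂ := 2 * k + 1) (by simp; omega) (by simp; omega)
          (by rw [he, he, hik])
        omega
      · have := inj (x₁ := 2 * i) (x₂ := 2 * k) (by simp; omega) (by simp; omega)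
          (by
            have h1 := hv i.castSucc
            have h2 := hv k.castSucc
            rw [Fin.val_castSucc] at h1 h2
            rw [h1, h2]
            exact congrArg _ hik)
        omega
      · have h1 := hv 0
        have h2 := hv (Fin.last m)
        rw [Fin.val_last, ← hm, c.getVert_length] at h2
        rw [Fin.val_zero, mul_zero, c.getVert_zero] at h1
        exact Sum.inl_injective (h1.symm.trans h2)
    rintro (x | e) c hc
    · exact main x c hc
    -- A cycle based at a hyperedge is rotated to its second node, which is a vertex of the
    -- hypergraph.
    · have h1 := c.adj_getVert_succ (i := 0) (by have := hc.three_le_length; omega)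
      rw [c.getVert_zero] at h1
      rcases hw : c.getVert (0 + 1) with y | f
      · have hy : Sum.inl y ∈ c.support := hw ▸ c.getVert_mem_support _
        exact main y _ (hc.rotate hy)
      · rw [hw] at h1
        exact h1

theorem card_incidenceGraph_edgeSet [Finite V] [Fintype E] :
    Nat.card H.incidenceGraph.edgeSet = ∑ e, (H.edge e).card := by
  have hf : ∀ q : Σ e, H.edge e, s(Sum.inl q.2.1, Sum.inr q.1) ∈ H.incidenceGraph.edgeSet :=
    fun q => q.2.2
  have hb : Function.Bijective fun q : Σ e, H.edge e =>
      (⟨s(Sum.inl q.2.1, Sum.inr q.1), hf q⟩ : H.incidenceGraph.edgeSet) := by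
    constructor
    · rintro ⟨e, v, hv⟩ ⟨f, w, hw⟩ h
      simp at h
      obtain ⟨rfl, rfl⟩ := h
      rfl
    · rintro ⟨q, hq⟩
      induction q with
      | h a b =>
        rcases a with v | e <;> rcases b with w | f
        · exact absurd hq id
        · exact ⟨⟨f, v, hq⟩, rfl⟩
        · exact ⟨⟨e, w, hq⟩, Subtype.ext Sym2.eq_swap⟩
        · exact absurd hq id
  rw [← Nat.card_eq_of_bijective _ hb, Nat.card_sigma]
  simp

theorem sum_card_eq [Fintype E] :
    ∑ e, (H.edge e).card = ∑ e, ((H.edge e).card - 1) + Nat.card E := by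
  rw [Nat.card_eq_fintype_card, ← Finset.card_univ, Finset.card_eq_sum_ones,
    ← Finset.sum_add_distrib]
  exact Finset.sum_congr rfl fun e _ => by have := H.two_le_card e; omega

/-- A connected graph has at most one more vertex than edges; for the incidence graph, `|E|` is then
subtracted from both sides. -/
theorem IsConnected.card_le [Finite V] [Fintype E] (h : H.IsConnected) :
    Nat.card V ≤ ∑ e, ((H.edge e).card - 1) + 1 := by
  have h1 := h.incidenceGraph_connected.card_vert_le_card_edgeSet_add_one
  rw [card_incidenceGraph_edgeSet, sum_card_eq, Nat.card_sum] at h1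
  omega

/-- A connected hypergraph is a hypertree if and only if it has as many vertices as possible. -/
theorem isHypertree_iff_card [Finite V] [Fintype E] :
    H.IsHypertree ↔ H.IsConnected ∧ Nat.card V = ∑ e, ((H.edge e).card - 1) + 1 := by
  refine and_congr_right fun hc => ?_
  have h1 := SimpleGraph.isTree_iff_connected_and_card (G := H.incidenceGraph)
  rw [SimpleGraph.isTree_iff, and_congr_right_iff] at h1
  rw [← incidenceGraph_isAcyclic_iff, h1 hc.incidenceGraph_connected,
    card_incidenceGraph_edgeSet, sum_card_eq, Nat.card_sum]
  omega

end LabeledHypergraph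

/-! ### Removal of the root edge -/

namespace LabeledHypergraph

variable {V E : Type}

open scoped Classical in
/-- The connected component of the vertex `r`. -/
noncomputable def component (H : LabeledHypergraph V E) (r : V) :
    LabeledHypergraph {v | H.Linked r v} {e | ∃ v ∈ H.edge e, H.Linked r v} where
  edge e := (H.edge e).subtype (· ∈ {v | H.Linked r v})
  two_le_card e := by
    obtain ⟨e, v, hv, hr⟩ := e
    rw [Finset.card_subtype, Finset.filter_true_of_mem]
    · exact H.two_le_card e
    · exact fun w hw => hr.trans (linked_of_mem hv hw)

variable {H : LabeledHypergraph V E} {r : V}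

theorem mem_component_edge {e : {e | ∃ v ∈ H.edge e, H.Linked r v}} {v : {v | H.Linked r v}} :
    v ∈ (H.component r).edge e ↔ v.1 ∈ H.edge e := by
  classical
  exact Finset.mem_subtype

theorem map_component_edge (e : {e | ∃ v ∈ H.edge e, H.Linked r v}) :
    ((H.component r).edge e).map (Function.Embedding.subtype _) = H.edge e := by
  ext v
  simp only [Finset.mem_map, mem_component_edge, Function.Embedding.subtype_apply, Subtype.exists,
    exists_and_right, exists_eq_right]
  obtain ⟨e, w, hw, hr⟩ := e
  exact ⟨fun h => h.2, fun h => ⟨hr.trans (linked_of_mem hw h), h⟩⟩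

theorem component_isConnected (H : LabeledHypergraph V E) (r : V) :
    (H.component r).IsConnected := by
  have key : ∀ v (h : H.Linked r v), (H.component r).Linked ⟨r, Linked.refl r⟩ ⟨v, h⟩ := by
    intro v h
    induction h with
    | refl => exact Linked.refl _
    | tail h1 h2 ih =>
      obtain ⟨e, hx, hy⟩ := h2
      exact ih.trans (linked_of_mem (e := ⟨e, _, hx, h1⟩) (mem_component_edge.2 hx)
        (mem_component_edge.2 hy))
  rw [isConnected_iff_linked]
  exact ⟨⟨⟨r, Linked.refl r⟩⟩, fun x y => (key x.1 x.2).symm.trans (key y.1 y.2)⟩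

/-- A cycle in a hypergraph that embeds into `H` is a cycle in `H`. -/
theorem IsCycle.map {V' E' : Type} {G : LabeledHypergraph V' E'} {m : ℕ}
    {v : Fin (m + 1) → V'} {e : Fin m → E'} (h : G.IsCycle v e) (f : V' → V) (g : E' → E)
    (hf : Function.Injective f) (hg : Function.Injective g)
    (hfg : ∀ v e, v ∈ G.edge e → f v ∈ H.edge (g e)) : H.IsCycle (f ∘ v) (g ∘ e) := by
  obtain ⟨h1, h2, h3, h4, h5⟩ := h
  exact ⟨fun i => ⟨hfg _ _ (h1 i).1, hfg _ _ (h1 i).2⟩, h2, hg.comp h3, hf.comp h4,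
    congrArg f h5⟩

theorem Linked.map {V' E' : Type} {G : LabeledHypergraph V' E'} {x y : V'} (h : G.Linked x y)
    (f : V' → V) (g : E' → E) (hfg : ∀ v e, v ∈ G.edge e → f v ∈ H.edge (g e)) :
    H.Linked (f x) (f y) :=
  Relation.ReflTransGen.lift f (fun _ _ ⟨e, hx, hy⟩ => ⟨g e, hfg _ _ hx, hfg _ _ hy⟩) _ _ h

/-- The hypergraph without the edge `none`. -/
def removeRootEdge (K : LabeledHypergraph V (Option E)) : LabeledHypergraph V E where
  edge e := K.edge (some e)
  two_le_card e := K.two_le_card (some e)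

variable {K : LabeledHypergraph V (Option E)}

theorem IsHypertree.component_removeRootEdge (h : K.IsHypertree) (r : V) :
    (K.removeRootEdge.component r).IsHypertree :=
  ⟨component_isConnected _ _, fun m _ _ hc => h.2 m _ _ <|
    hc.map Subtype.val (fun e => some e.1) Subtype.val_injective
      ((Option.some_injective _).comp Subtype.val_injective)
      fun _ _ h => mem_component_edge.1 h⟩

/-- A path between two distinct vertices of the root edge that avoids this edge would be closed by
it to a cycle. -/
theorem IsHypertree.eq_of_linked_removeRootEdge (h : K.IsHypertree) {x y : V}
    (hx : x ∈ K.edge none) (hy : y ∈ K.edge none) (hxy : K.removeRootEdge.Linked x y) :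
    x = y := by
  obtain ⟨m, v, e, ⟨hw, hv, he⟩, rfl, rfl⟩ := hxy.exists_isPath
  by_contra hne
  have hm : m ≠ 0 := by
    rintro rfl
    exact hne rfl
  refine h.2 (m + 1) (Fin.snoc v (v 0) : Fin (m + 1 + 1) → V)
    (Fin.snoc (fun i => some (e i)) none : Fin (m + 1) → Option E) ⟨?_, by omega, ?_, ?_, ?_⟩
  · intro i
    induction i using Fin.lastCases with
    | last =>
      rw [Fin.snoc_castSucc, Fin.succ_last, Fin.snoc_last, Fin.snoc_last]
      exact ⟨hy, hx⟩
    | cast i =>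
      rw [Fin.snoc_castSucc, Fin.snoc_castSucc, Fin.succ_castSucc, Fin.snoc_castSucc]
      exact hw i
  · rw [Fin.snoc_injective_iff]
    exact ⟨(Option.some_injective _).comp he, by simp⟩
  · simpa [Fin.snoc_castSucc] using hv
  · rw [Fin.snoc_last]
    exact Fin.snoc_castSucc (α := fun _ => V) (v 0) v 0

/-- Follow a walk from a vertex of the root edge; whenever it uses the root edge, restart at the
vertex reached, which also lies in that edge. -/
theorem IsConnected.exists_linked_removeRootEdge (h : K.IsConnected) (v : V) :
    ∃ r ∈ K.edge none, K.removeRootEdge.Linked r v := by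
  obtain ⟨r, hr⟩ := K.edge_nonempty none
  have hv := (isConnected_iff_linked.1 h).2 r v
  induction hv with
  | refl => exact ⟨r, hr, Linked.refl r⟩
  | tail _ h2 ih =>
    obtain ⟨_ | e, hx, hy⟩ := h2
    · exact ⟨_, hy, Linked.refl _⟩
    · obtain ⟨s, hs, hsx⟩ := ih
      exact ⟨s, hs, hsx.trans (linked_of_mem (e := e) hx hy)⟩

end LabeledHypergraph

open LabeledHypergraph

namespace VertexRootedHypertree

variable {V E : Type}

/-- Edges are compared inside the ambient vertex set, which avoids transport between the subtypes of
`P` and `Q`. -/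
theorem eq_of_edge_eq {P Q : VertexRootedHypertree V E} (hv : P.verts = Q.verts)
    (hl : P.labels = Q.labels) (hr : (P.root : V) = Q.root)
    (he : ∀ e (h : e ∈ P.labels) (h' : e ∈ Q.labels), P.edge ⟨e, h⟩ = Q.edge ⟨e, h'⟩) :
    P = Q := by
  obtain ⟨A, B, G, hG, r⟩ := P
  obtain ⟨A', B', G', hG', r'⟩ := Q
  dsimp only at hv hl
  subst hv hl
  obtain rfl : r = r' := Subtype.ext hr
  obtain rfl : G = G' := by
    ext1
    funext e
    exact Finset.map_injective _ (he e e.2 e.2)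
  rfl

theorem mem_edge {P : VertexRootedHypertree V E} {e : P.labels} {v : P.verts} :
    v.1 ∈ P.edge e ↔ v ∈ P.graph.edge e := by
  simp [VertexRootedHypertree.edge]

theorem mem_verts_of_mem_edge {P : VertexRootedHypertree V E} {e : P.labels} {v : V}
    (h : v ∈ P.edge e) : v ∈ P.verts := by
  obtain ⟨w, -, rfl⟩ := Finset.mem_map.1 h
  exact w.2

theorem card_edge (P : VertexRootedHypertree V E) (e : P.labels) :
    (P.edge e).card = (P.graph.edge e).card :=
  Finset.card_map _

theorem linked {P : VertexRootedHypertree V E} {E' : Type} {H : LabeledHypergraph V E'}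
    (g : E → E') (h : ∀ e : P.labels, P.edge e = H.edge (g e)) {x y : V} (hx : x ∈ P.verts)
    (hy : y ∈ P.verts) : H.Linked x y :=
  ((isConnected_iff_linked.1 P.isHypertree.1).2 ⟨x, hx⟩ ⟨y, hy⟩).map Subtype.val (fun e => g e.1)
    fun _ e hv => h e ▸ mem_edge.2 hv

instance [Finite V] [Finite E] : Finite (VertexRootedHypertree V E) := by
  refine Finite.of_injective (β := Σ A : Set V, Σ B : Set E, LabeledHypergraph A B × A)
    (fun P => ⟨P.verts, P.labels, P.graph, P.root⟩) ?_
  rintro ⟨A, B, G, hG, r⟩ ⟨A', B', G', hG', r'⟩ h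
  simp only [Sigma.mk.injEq] at h
  obtain ⟨rfl, h⟩ := h
  simp only [heq_eq_eq, Sigma.mk.injEq] at h
  obtain ⟨rfl, h⟩ := h
  simp only [heq_eq_eq, Prod.mk.injEq] at h
  obtain ⟨rfl, rfl⟩ := h
  rfl

end VertexRootedHypertree

theorem bijective_sigma_val_of_existsUnique {ι X : Type} {A : ι → Set X}
    (h : ∀ x, ∃! i, x ∈ A i) : Function.Bijective fun q : Σ i, A i => q.2.1 := by
  constructor
  · rintro ⟨i, x, hx⟩ ⟨k, y, hy⟩ (rfl : x = y)
    obtain rfl := (h x).unique hx hy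
    rfl
  · intro x
    obtain ⟨i, hi, -⟩ := h x
    exact ⟨⟨i, x, hi⟩, rfl⟩

section Removal

variable {n : ℕ} {l : EdgeSize →₀ ℕ} {j : ℕ}

instance : Finite (EdgeRootedHypertree n l j) :=
  Subtype.finite

instance : Finite (VertexRootedHypertreeSet n l j) := by
  have := Fintype.ofFinite (VertexRootedHypertree (Fin n) (EdgeLabel l))
  exact inferInstanceAs (Finite {S : Finset (VertexRootedHypertree (Fin n) (EdgeLabel l)) // _})

theorem exists_isRemovalOfRootEdge (H : EdgeRootedHypertree n l j) :
    ∃ S : VertexRootedHypertreeSet n l j, IsRemovalOfRootEdge H S := by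
  classical
  obtain ⟨K, hK, hj, hs⟩ := H
  let P : Fin n → VertexRootedHypertree (Fin n) (EdgeLabel l) := fun r =>
    ⟨_, _, K.removeRootEdge.component r, hK.component_removeRootEdge r, ⟨r, Linked.refl r⟩⟩
  -- The root is part of the data, so injectivity holds even for two vertices of the same component.
  have hP : Function.Injective P := fun r s h =>
    congrArg (fun Q : VertexRootedHypertree (Fin n) (EdgeLabel l) => (Q.root : Fin n)) h
  have hedge : ∀ r (e : (P r).labels), (P r).edge e = K.edge (some e.1) :=
    fun r e => map_component_edge e
  refine ⟨⟨(K.edge none).image P, ?_, ?_, ?_, ?_⟩, ?_, ?_⟩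
  · rw [Finset.card_image_of_injective _ hP, hj]
  · intro v
    obtain ⟨r, hr, hrv⟩ := hK.1.exists_linked_removeRootEdge v
    refine ⟨P r, ⟨Finset.mem_image_of_mem _ hr, hrv⟩, ?_⟩
    rintro Q ⟨hQ, hv⟩
    obtain ⟨s, hs, rfl⟩ := Finset.mem_image.1 hQ
    have hsv : K.removeRootEdge.Linked s v := hv
    rw [hK.eq_of_linked_removeRootEdge hs hr (hsv.trans hrv.symm)]
  · intro e
    obtain ⟨v, hv⟩ := K.edge_nonempty (some e)
    obtain ⟨r, hr, hrv⟩ := hK.1.exists_linked_removeRootEdge v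
    refine ⟨P r, ⟨Finset.mem_image_of_mem _ hr, ⟨v, hv, hrv⟩⟩, ?_⟩
    rintro Q ⟨hQ, he⟩
    obtain ⟨s, hs, rfl⟩ := Finset.mem_image.1 hQ
    obtain ⟨w, hw, hsw⟩ : ∃ w ∈ K.removeRootEdge.edge e, K.removeRootEdge.Linked s w := he
    have hvw : K.removeRootEdge.Linked w v := linked_of_mem (e := e) hw hv
    rw [hK.eq_of_linked_removeRootEdge hs hr ((hsw.trans hvw).trans hrv.symm)]
  · intro Q hQ e
    obtain ⟨r, hr, rfl⟩ := Finset.mem_image.1 hQ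
    rw [hedge]
    exact hs _
  · intro v
    simp [P]
  · intro Q hQ e
    obtain ⟨r, hr, rfl⟩ := Finset.mem_image.1 hQ
    exact hedge r e

namespace IsRemovalOfRootEdge

variable {H : EdgeRootedHypertree n l j} {S : VertexRootedHypertreeSet n l j}
  {P : VertexRootedHypertree (Fin n) (EdgeLabel l)}

/-- The edge `e` belongs to some member of `S`; that member shares the vertex `x` with `P`, so it is
`P`. -/
theorem mem_verts_and_labels (h : IsRemovalOfRootEdge H S) (hP : P ∈ S.1) {x : Fin n}
    {e : EdgeLabel l} (hx : x ∈ P.verts) (he : x ∈ H.1.edge (some e)) :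
    e ∈ P.labels ∧ ∀ y ∈ H.1.edge (some e), y ∈ P.verts := by
  obtain ⟨Q, ⟨hQ, heQ⟩, -⟩ := S.2.2.2.1 e
  have hQe := h.2 Q hQ ⟨e, heQ⟩
  rw [← hQe] at he ⊢
  obtain rfl := (S.2.2.1 x).unique ⟨hP, hx⟩ ⟨hQ, Q.mem_verts_of_mem_edge he⟩
  exact ⟨heQ, fun y hy => P.mem_verts_of_mem_edge hy⟩

/-- Each member of `S` is connected and closed under adjacency, hence a full component of `H`
without its root edge. So `H` determines `S`. -/
theorem verts_eq (h : IsRemovalOfRootEdge H S) (hP : P ∈ S.1) :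
    P.verts = {v | H.1.removeRootEdge.Linked P.root v} := by
  ext v
  refine ⟨fun hv => P.linked id (h.2 P hP) P.root.2 hv, fun hv => ?_⟩
  change Relation.ReflTransGen _ _ _ at hv
  induction hv with
  | refl => exact P.root.2
  | tail _ h2 ih =>
    obtain ⟨e, hx, hy⟩ := h2
    exact (h.mem_verts_and_labels hP ih hx).2 _ hy

theorem labels_eq (h : IsRemovalOfRootEdge H S) (hP : P ∈ S.1) :
    P.labels = {e | ∃ v ∈ H.1.edge (some e), v ∈ P.verts} := by
  ext e
  constructor
  · intro he
    obtain ⟨v, hv⟩ := P.graph.edge_nonempty ⟨e, he⟩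
    exact ⟨v, h.2 P hP ⟨e, he⟩ ▸ VertexRootedHypertree.mem_edge.2 hv, v.2⟩
  · rintro ⟨v, hv, hvP⟩
    exact (h.mem_verts_and_labels hP hvP hv).1

theorem right_subset {S' : VertexRootedHypertreeSet n l j} (h : IsRemovalOfRootEdge H S)
    (h' : IsRemovalOfRootEdge H S') : S.1 ⊆ S'.1 := by
  intro P hP
  obtain ⟨Q, hQ, hr⟩ := (h'.1 P.root).1 ((h.1 P.root).2 ⟨P, hP, rfl⟩)
  have hv : P.verts = Q.verts := by rw [h.verts_eq hP, h'.verts_eq hQ, hr]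
  have hl : P.labels = Q.labels := by rw [h.labels_eq hP, h'.labels_eq hQ, hv]
  rwa [VertexRootedHypertree.eq_of_edge_eq hv hl hr.symm fun e he he' => by
    rw [h.2 P hP, h'.2 Q hQ]]

theorem right_unique {S' : VertexRootedHypertreeSet n l j} (h : IsRemovalOfRootEdge H S)
    (h' : IsRemovalOfRootEdge H S') : S = S' :=
  Subtype.ext ((h.right_subset h').antisymm (h'.right_subset h))

theorem left_unique {H' : EdgeRootedHypertree n l j} (h : IsRemovalOfRootEdge H S)
    (h' : IsRemovalOfRootEdge H' S) : H = H' := by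
  apply Subtype.ext
  ext1
  funext e
  rcases e with _ | e
  · ext v
    rw [h.1, h'.1]
  · obtain ⟨P, ⟨hP, he⟩, -⟩ := S.2.2.2.1 e
    rw [← h.2 P hP ⟨e, he⟩, ← h'.2 P hP ⟨e, he⟩]

end IsRemovalOfRootEdge

theorem exists_isRemovalOfRootEdge_right (hj : 2 ≤ j) (S : VertexRootedHypertreeSet n l j) :
    ∃ H : EdgeRootedHypertree n l j, IsRemovalOfRootEdge H S := by
  classical
  have := Fintype.ofFinite (EdgeLabel l)
  obtain ⟨S, hS, hv, he, hs⟩ := S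
  have hroots : Set.InjOn (fun P : VertexRootedHypertree (Fin n) (EdgeLabel l) => (P.root : Fin n))
      S := fun P hP Q hQ h =>
    (hv P.root).unique ⟨hP, P.root.2⟩ ⟨hQ, by
      have h' : (P.root : Fin n) = Q.root := h
      rw [h']
      exact Q.root.2⟩
  have hroot_card : (S.image fun P => (P.root : Fin n)).card = j := by
    rw [Finset.card_image_of_injOn hroots, hS]
  have hex := he
  choose Q hQ hQu using hex
  let K : LabeledHypergraph (Fin n) (Option (EdgeLabel l)) :=
    { edge := fun e => e.elim (S.image fun P => (P.root : Fin n)) fun e => (Q e).edge ⟨e, (hQ e).2⟩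
      two_le_card := by
        rintro (_ | e)
        · exact hroot_card.symm ▸ hj
        · exact ((Q e).card_edge _).symm ▸ (Q e).graph.two_le_card _ }
  have hKs : ∀ P ∈ S, ∀ e : P.labels, P.edge e = K.edge (some e) := by
    rintro P hP ⟨e, he⟩
    obtain rfl := hQu e P ⟨hP, he⟩
    rfl
  have hKn : ∀ v, v ∈ K.edge none ↔ ∃ P ∈ S, (P.root : Fin n) = v :=
    fun v => Finset.mem_image
  have hconn : K.IsConnected := by
    have hne : S.Nonempty := Finset.card_pos.1 (by omega)
    obtain ⟨P, hP⟩ := hne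
    refine isConnected_iff_linked.2 ⟨⟨P.root⟩, fun x y => ?_⟩
    obtain ⟨A, ⟨hA, hxA⟩, -⟩ := hv x
    obtain ⟨B, ⟨hB, hyB⟩, -⟩ := hv y
    have h1 : K.Linked x A.root := A.linked some (hKs A hA) hxA A.root.2
    have h2 : K.Linked B.root y := B.linked some (hKs B hB) B.root.2 hyB
    exact h1.trans ((linked_of_mem (e := none) ((hKn _).2 ⟨A, hA, rfl⟩)
      ((hKn _).2 ⟨B, hB, rfl⟩)).trans h2)
  have htree : K.IsHypertree := by
    -- No cycle has to be examined. The `j` trees together have `∑ (|e| - 1) + j` vertices, and the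
    -- root edge contributes `j - 1` to the required count `∑ (|e| - 1) + (j - 1) + 1`.
    refine isHypertree_iff_card.2 ⟨hconn, ?_⟩
    have hv' := bijective_sigma_val_of_existsUnique (A := fun P : S => P.1.verts) fun v => by
      obtain ⟨P, ⟨hP, hvP⟩, hu⟩ := hv v
      exact ⟨⟨P, hP⟩, hvP, fun R hR => Subtype.ext (hu R.1 ⟨R.2, hR⟩)⟩
    have he' := bijective_sigma_val_of_existsUnique (A := fun P : S => P.1.labels) fun e =>
      ⟨⟨Q e, (hQ e).1⟩, (hQ e).2, fun R hR => Subtype.ext (hQu e R.1 ⟨R.2, hR⟩)⟩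
    have hsum : ∑ e, ((K.edge (some e)).card - 1) =
        ∑ P : S, ∑ e : P.1.labels, ((P.1.graph.edge e).card - 1) := by
      rw [← Fintype.sum_sigma']
      refine (Fintype.sum_bijective _ he' _ _ ?_).symm
      rintro ⟨P, e⟩
      rw [← hKs P.1 P.2, P.1.card_edge]
    rw [← Nat.card_eq_of_bijective _ hv', Nat.card_sigma, Fintype.sum_option, hsum]
    have hcard : ∀ P : S, Nat.card P.1.verts =
        ∑ e : P.1.labels, ((P.1.graph.edge e).card - 1) + 1 :=
      fun P => (isHypertree_iff_card.1 P.1.isHypertree).2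
    rw [Finset.sum_congr rfl fun P _ => hcard P, Finset.sum_add_distrib]
    have hn : (K.edge none).card = j := hroot_card
    rw [hn]
    simp [hS]
    omega
  refine ⟨⟨K, htree, hroot_card, fun e => ?_⟩, hKn, hKs⟩
  exact hs (Q e) (hQ e).1 ⟨e, (hQ e).2⟩

/-- Removing the root edge is a bijection. -/
theorem exists_equiv_isRemovalOfRootEdge (hj : 2 ≤ j) (n : ℕ) (l : EdgeSize →₀ ℕ) :
    ∃ Φ : EdgeRootedHypertree n l j ≃ VertexRootedHypertreeSet n l j,
      ∀ H, IsRemovalOfRootEdge H (Φ H) := by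
  choose f hf using exists_isRemovalOfRootEdge (n := n) (l := l) (j := j)
  choose g hg using fun S : VertexRootedHypertreeSet n l j =>
    exists_isRemovalOfRootEdge_right hj S
  exact ⟨⟨f, g, fun H => (hg (f H)).left_unique (hf H),
    fun S => (hf (g S)).right_unique (hg S)⟩, hf⟩

end Removal

/-! ### Counting hypertrees on arbitrary finite label sets -/

open LabeledHypergraph

section Relabeling

variable {V E V' E' : Type}

/-- Hypertrees on the vertex set `V` with edge labels `E` and prescribed edge sizes. -/
abbrev SizedHypertree (V E : Type) (c : E → EdgeSize) : Type :=
  {H : LabeledHypergraph V E // H.IsHypertree ∧ ∀ e, (H.edge e).card = (c e).1}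

namespace LabeledHypergraph

/-- The hypergraph with renamed vertices and edges. -/
def relabel (H : LabeledHypergraph V E) (f : V ≃ V') (g : E ≃ E') : LabeledHypergraph V' E' where
  edge e := (H.edge (g.symm e)).map f.toEmbedding
  two_le_card e := by
    rw [Finset.card_map]
    exact H.two_le_card _

theorem IsHypertree.relabel {H : LabeledHypergraph V E} (h : H.IsHypertree) (f : V ≃ V')
    (g : E ≃ E') : (H.relabel f g).IsHypertree := by
  obtain ⟨h1, h2⟩ := h
  refine ⟨?_, fun m v e hc => h2 m _ _ (hc.map f.symm g.symm f.symm.injective g.symm.injective ?_)⟩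
  · obtain ⟨⟨x⟩, h1⟩ := isConnected_iff_linked.1 h1
    refine isConnected_iff_linked.2 ⟨⟨f x⟩, fun x y => ?_⟩
    have := (h1 (f.symm x) (f.symm y)).map (H := H.relabel f g) f g fun v e hv => by
      simpa [LabeledHypergraph.relabel] using hv
    simpa using this
  · intro v e hv
    simpa [LabeledHypergraph.relabel] using hv

theorem relabel_injective (f : V ≃ V') (g : E ≃ E') :
    Function.Injective fun H : LabeledHypergraph V E => H.relabel f g := by
  intro H H' h
  ext1
  funext e
  have := congrFun (congrArg LabeledHypergraph.edge h) (g e)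
  simpa [LabeledHypergraph.relabel] using this

end LabeledHypergraph

theorem card_sizedHypertree_le [Finite V'] [Finite E'] {c : E → EdgeSize} {c' : E' → EdgeSize}
    (f : V ≃ V') (g : E ≃ E') (hc : ∀ e, c' (g e) = c e) :
    Nat.card (SizedHypertree V E c) ≤ Nat.card (SizedHypertree V' E' c') := by
  refine Nat.card_le_card_of_injective
    (fun H => ⟨H.1.relabel f g, H.2.1.relabel f g, fun e => ?_⟩)
    fun H H' h => Subtype.ext (relabel_injective f g (congrArg Subtype.val h))
  rw [LabeledHypergraph.relabel, Finset.card_map, H.2.2, ← hc, g.apply_symm_apply]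

theorem card_sizedHypertree_congr [Finite V] [Finite E] {c : E → EdgeSize} {c' : E' → EdgeSize}
    (f : V ≃ V') (g : E ≃ E') (hc : ∀ e, c' (g e) = c e) :
    Nat.card (SizedHypertree V E c) = Nat.card (SizedHypertree V' E' c') := by
  have := Finite.of_equiv V f
  have := Finite.of_equiv E g
  exact (card_sizedHypertree_le f g hc).antisymm
    (card_sizedHypertree_le f.symm g.symm fun e => by rw [← hc, g.apply_symm_apply])

theorem colorCount_apply {σ α : Type} [Fintype α] (c : α → σ) (s : σ) :
    colorCount c s = Nat.card {a // c a = s} := by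
  classical
  simp [colorCount, Finsupp.single_apply, Fintype.card_subtype]

theorem colorCount_edgeLabel (l : EdgeSize →₀ ℕ) [Fintype (EdgeLabel l)] :
    colorCount (fun e : EdgeLabel l => e.1) = l := by
  ext s
  rw [colorCount_apply, Nat.card_congr (Equiv.sigmaSubtype s), Nat.card_fin]

theorem exists_equiv_edgeLabel [Fintype E] (c : E → EdgeSize) :
    ∃ g : E ≃ EdgeLabel (colorCount c), ∀ e, (g e).1 = c e := by
  have h : ∀ s, Nonempty ({e // c e = s} ≃ Fin (colorCount c s)) := fun s =>
    ⟨Finite.equivFinOfCardEq (colorCount_apply c s).symm⟩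
  let k := fun s => (h s).some
  exact ⟨(Equiv.sigmaFiberEquiv c).symm.trans (Equiv.sigmaCongrRight k), fun e => rfl⟩

/-- The count depends only on the number of vertices and of edges of each size. This transfers it to
label sets such as `Option (EdgeLabel l)` or the fibres of a distribution of labels. -/
theorem card_sizedHypertree [Finite V] [Fintype E] (c : E → EdgeSize) :
    Nat.card (SizedHypertree V E c) = (Hypertrees (Nat.card V) (colorCount c)).ncard := by
  obtain ⟨g, hg⟩ := exists_equiv_edgeLabel c
  exact card_sizedHypertree_congr (c' := fun e => e.1) (Finite.equivFin V) g hg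

end Relabeling

/-! ### Magnitude and the extremal case -/

theorem magnitude_colorCount {E : Type} [Fintype E] (c : E → EdgeSize) :
    magnitude (colorCount c) = ∑ e, ((c e).1 - 1) := by
  classical
  rw [magnitude, colorCount, ← Finsupp.sum_finsetSum_index (by simp) (by simp [mul_add])]
  simp

theorem magnitude_eq_sum (l : EdgeSize →₀ ℕ) [Fintype (EdgeLabel l)] :
    magnitude l = ∑ e : EdgeLabel l, (e.size - 1) := by
  exact (congrArg magnitude (colorCount_edgeLabel l)).symm.trans (magnitude_colorCount _)

theorem le_magnitude_of_mem_connectedHypergraphs {n : ℕ} {l : EdgeSize →₀ ℕ}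
    {H : LabeledHypergraph (Fin n) (EdgeLabel l)} (h : H ∈ ConnectedHypergraphs n l) :
    n ≤ magnitude l + 1 := by
  have := Fintype.ofFinite (EdgeLabel l)
  have h1 := h.1.card_le
  rw [Nat.card_fin] at h1
  rw [magnitude_eq_sum]
  simpa [h.2] using h1

theorem hypertrees_eq (n : ℕ) (l : EdgeSize →₀ ℕ) :
    Hypertrees n l = {H | H ∈ ConnectedHypergraphs n l ∧ n = magnitude l + 1} := by
  have := Fintype.ofFinite (EdgeLabel l)
  ext H
  constructor
  · rintro ⟨h1, h2⟩
    obtain ⟨h3, h4⟩ := isHypertree_iff_card.1 h1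
    refine ⟨⟨h3, h2⟩, ?_⟩
    rw [magnitude_eq_sum]
    simpa [h2] using h4
  · rintro ⟨⟨h1, h2⟩, h3⟩
    refine ⟨isHypertree_iff_card.2 ⟨h1, ?_⟩, h2⟩
    rw [magnitude_eq_sum] at h3
    simpa [h2] using h3

theorem egfCoeff_T_eq_ncard_hypertrees (n : ℕ) (l : EdgeSize →₀ ℕ) :
    egfCoeff T n l = (Hypertrees n l).ncard := by
  rw [egfCoeff_T, hypertrees_eq]
  split_ifs with h
  · simp [h]
  · have : n ≠ magnitude l + 1 := fun hc => h hc.symm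
    simp [this]

theorem egfCoeff_pderiv_T (j : ℕ) (hj : 2 ≤ j) (n : ℕ) (l : EdgeSize →₀ ℕ) :
    egfCoeff (MvPowerSeries.pderiv ℚ (uVar j hj) T) n l =
      Nat.card (EdgeRootedHypertree n l j) := by
  have := Fintype.ofFinite (EdgeLabel l)
  -- The additional edge of size `j` created by the index shift is labeled `none` and becomes the
  -- root edge.
  let c : Option (EdgeLabel l) → EdgeSize := fun e => e.elim ⟨j, hj⟩ fun e => e.1
  have hc : colorCount c = l + Finsupp.single ⟨j, hj⟩ 1 := by
    rw [colorCount, Fintype.sum_option, add_comm]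
    congr 1
    exact colorCount_edgeLabel l
  have h := card_sizedHypertree (V := Fin n) c
  rw [Nat.card_fin, hc] at h
  rw [egfCoeff_pderiv_uVar, egfCoeff_T_eq_ncard_hypertrees, ← h]
  congr 1
  refine Nat.card_congr (Equiv.subtypeEquivRight fun H => ?_)
  rw [Option.forall]
  rfl

/-! ### Counting sets of vertex-rooted hypertrees -/

theorem optionElim_colorCount {V E : Type} [Fintype V] [Fintype E] (c : E → EdgeSize) :
    colorCount (fun _ : V => (none : Option EdgeSize)) + colorCount (fun e => some (c e)) =
      Finsupp.optionElim (Nat.card V) (colorCount c) := by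
  classical
  ext (_ | s)
  · simp [colorCount_apply]
  · simp [colorCount_apply]

/-- The colour of a vertex is `t` and the colour of an `i`-edge is `u_i`. -/
def labelColor {V E : Type} (c : E → EdgeSize) : V ⊕ E → Option EdgeSize :=
  Sum.elim (fun _ => none) fun e => some (c e)

theorem colorCount_labelColor {V E : Type} [Fintype V] [Fintype E] (c : E → EdgeSize) :
    colorCount (labelColor (V := V) c) = Finsupp.optionElim (Nat.card V) (colorCount c) := by
  rw [← optionElim_colorCount, colorCount, Fintype.sum_sum_type]
  rfl

theorem fiberCount_labelColor {V E ι : Type} [Fintype V] [Fintype E] [DecidableEq ι]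
    (c : E → EdgeSize) (h : V ⊕ E → ι) (i : ι) [Fintype {e | h (.inr e) = i}] :
    fiberCount (labelColor c) h i = Finsupp.optionElim (Nat.card {v | h (.inl v) = i})
      (colorCount fun e : {e | h (.inr e) = i} => c e) := by
  classical
  have := Fintype.ofFinite {v | h (.inl v) = i}
  rw [← optionElim_colorCount, fiberCount, Fintype.sum_sum_type]
  congr 1
  · exact fiberCount_eq_colorCount (fun _ => none) (fun v => h (.inl v)) i
  · exact fiberCount_eq_colorCount (fun e => some (c e)) (fun e => h (.inr e)) i

section Families

variable {V E : Type} {c : E → EdgeSize}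

/-- Hypertrees on `A` with edge labels `B` and a chosen root. -/
abbrev RootedSizedHypertree (c : E → EdgeSize) (A : Set V) (B : Set E) : Type :=
  SizedHypertree A B (fun e => c e) × A

/-- A rooted hypertree as a rooted hypertree on a subset. -/
def RootedSizedHypertree.toVertexRooted {A : Set V} {B : Set E}
    (P : RootedSizedHypertree c A B) : VertexRootedHypertree V E :=
  ⟨A, B, P.1.1, P.1.2.1, P.2⟩

theorem RootedSizedHypertree.toVertexRooted_injective {A : Set V} {B : Set E} :
    Function.Injective
      (toVertexRooted : RootedSizedHypertree c A B → VertexRootedHypertree V E) := by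
  rintro ⟨⟨G, hG⟩, r⟩ ⟨⟨G', hG'⟩, r'⟩ h
  simp only [toVertexRooted, VertexRootedHypertree.mk.injEq, heq_eq_eq, true_and] at h
  obtain ⟨rfl, rfl⟩ := h
  rfl

theorem VertexRootedHypertree.exists_toVertexRooted_eq (P : VertexRootedHypertree V E)
    {A : Set V} {B : Set E} (hA : P.verts = A) (hB : P.labels = B)
    (h : ∀ e : P.labels, (P.edge e).card = (c e).1) :
    ∃ Q : RootedSizedHypertree c A B, Q.toVertexRooted = P := by
  subst hA hB
  exact ⟨⟨⟨P.graph, P.isHypertree, fun e => (P.card_edge e).symm.trans (h e)⟩, P.root⟩, rfl⟩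

/-- Families of vertex-rooted hypertrees whose vertices and edge labels partition `V` and `E`. -/
abbrev VertexRootedHypertreeFamily (V : Type) (c : E → EdgeSize) (j : ℕ) : Type :=
  {q : Fin j → VertexRootedHypertree V E // (∀ v, ∃! i, v ∈ (q i).verts) ∧
    (∀ e, ∃! i, e ∈ (q i).labels) ∧ ∀ i, ∀ e : (q i).labels, ((q i).edge e).card = (c e).1}

/-- A family is the same as a map `h` sending each label to the index of the tree using it, plus a
rooted hypertree on each fibre. This is the shape of the sum in `expCoeff_prod`. -/
theorem card_vertexRootedHypertreeFamily (j : ℕ) :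
    Nat.card (VertexRootedHypertreeFamily V c j) = Nat.card (Σ h : V ⊕ E → Fin j,
      ∀ i, RootedSizedHypertree c {v | h (.inl v) = i} {e | h (.inr e) = i}) := by
  symm
  refine Nat.card_eq_of_bijective
    (fun x => ⟨fun i => (x.2 i).toVertexRooted, fun v => ⟨x.1 (.inl v), rfl, fun i hi => ?_⟩,
      fun e => ⟨x.1 (.inr e), rfl, fun i hi => ?_⟩, fun i e => ?_⟩) ⟨?_, ?_⟩
  · exact Eq.symm hi
  · exact Eq.symm hi
  · exact (VertexRootedHypertree.card_edge _ e).trans ((x.2 i).1.2.2 e)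
  · rintro ⟨h, x⟩ ⟨h', x'⟩ heq
    have heq' : ∀ i, (x i).toVertexRooted = (x' i).toVertexRooted :=
      congrFun (congrArg Subtype.val heq)
    obtain rfl : h = h' := by
      funext a
      rcases a with v | e
      · have h1 : v ∈ (x (h (.inl v))).toVertexRooted.verts := rfl
        rw [heq'] at h1
        exact Eq.symm h1
      · have h1 : e ∈ (x (h (.inr e))).toVertexRooted.labels := rfl
        rw [heq'] at h1
        exact Eq.symm h1
    congr 1
    funext i
    exact RootedSizedHypertree.toVertexRooted_injective (heq' i)
  · rintro ⟨q, hv, he, hs⟩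
    have hv' := hv
    have he' := he
    choose f hf hfu using hv'
    choose g hg hgu using he'
    have key : ∀ i, ∃ Q : RootedSizedHypertree c {v | f v = i} {e | g e = i},
        Q.toVertexRooted = q i := by
      intro i
      refine (q i).exists_toVertexRooted_eq ?_ ?_ (hs i)
      · ext v
        exact ⟨fun h => (hfu v i h).symm, fun h => by rw [← (show f v = i from h)]; exact hf v⟩
      · ext e
        exact ⟨fun h => (hgu e i h).symm, fun h => by rw [← (show g e = i from h)]; exact hg e⟩
    choose Q hQ using key
    exact ⟨⟨Sum.elim f g, Q⟩, Subtype.ext (funext hQ)⟩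

/-- The members of a family are distinct, since each root lies in one vertex set only; hence every
set of trees has exactly `j!` orderings. -/
theorem card_family_eq_factorial_mul (n : ℕ) (l : EdgeSize →₀ ℕ) (j : ℕ) :
    Nat.card (VertexRootedHypertreeFamily (Fin n) (fun e : EdgeLabel l => e.1) j) =
      j ! * Nat.card (VertexRootedHypertreeSet n l j) := by
  classical
  have := Fintype.ofFinite (VertexRootedHypertreeSet n l j)
  have hcard : Nat.card (Σ S : VertexRootedHypertreeSet n l j, (Fin j ≃ S.1)) =
      j ! * Nat.card (VertexRootedHypertreeSet n l j) := by
    rw [Nat.card_sigma]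
    have : ∀ S : VertexRootedHypertreeSet n l j, Nat.card (Fin j ≃ S.1) = j ! := fun S => by
      have e : Fin j ≃ S.1 := (S.1.equivFinOfCardEq S.2.1).symm
      rw [Nat.card_eq_fintype_card, Fintype.card_equiv e, Fintype.card_fin]
    rw [Finset.sum_congr rfl fun S _ => this S]
    simp [mul_comm]
  rw [← hcard]
  symm
  refine Nat.card_eq_of_bijective (fun x => ⟨fun i => (x.2 i).1, ?_, ?_, ?_⟩) ⟨?_, ?_⟩
  · intro v
    obtain ⟨P, ⟨hP, hvP⟩, hu⟩ := x.1.2.2.1 v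
    refine ⟨x.2.symm ⟨P, hP⟩, by simpa using hvP, fun i hi => ?_⟩
    rw [Equiv.eq_symm_apply]
    exact Subtype.ext (hu _ ⟨(x.2 i).2, hi⟩)
  · intro e
    obtain ⟨P, ⟨hP, heP⟩, hu⟩ := x.1.2.2.2.1 e
    refine ⟨x.2.symm ⟨P, hP⟩, by simpa using heP, fun i hi => ?_⟩
    rw [Equiv.eq_symm_apply]
    exact Subtype.ext (hu _ ⟨(x.2 i).2, hi⟩)
  · exact fun i e => x.1.2.2.2.2 _ (x.2 i).2 e
  · rintro ⟨S, e⟩ ⟨S', e'⟩ h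
    have h' : ∀ i, (e i).1 = (e' i).1 := congrFun (congrArg Subtype.val h)
    obtain rfl : S = S' := by
      apply Subtype.ext
      ext P
      constructor
      · intro hP
        have := h' (e.symm ⟨P, hP⟩)
        rw [e.apply_symm_apply] at this
        exact (show P = _ from this) ▸ (e' _).2
      · intro hP
        have := h' (e'.symm ⟨P, hP⟩)
        rw [e'.apply_symm_apply] at this
        exact (show _ = P from this) ▸ (e _).2
    congr 1
    exact Equiv.ext fun i => Subtype.ext (h' i)
  · rintro ⟨q, hv, he, hs⟩
    have hq : Function.Injective q := fun i k h =>
      (hv (q i).root).unique (q i).root.2 (h ▸ (q i).root.2)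
    have hmem : ∀ P, P ∈ Finset.univ.map ⟨q, hq⟩ ↔ ∃ i, q i = P := by simp
    refine ⟨⟨⟨Finset.univ.map ⟨q, hq⟩, by simp, fun v => ?_, fun e => ?_, fun P hP e => ?_⟩,
      Equiv.ofBijective (fun i => ⟨q i, (hmem _).2 ⟨i, rfl⟩⟩) ⟨?_, ?_⟩⟩, rfl⟩
    · obtain ⟨i, hi, hu⟩ := hv v
      refine ⟨q i, ⟨(hmem _).2 ⟨i, rfl⟩, hi⟩, ?_⟩
      rintro P ⟨hP, hvP⟩
      obtain ⟨k, rfl⟩ := (hmem _).1 hP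
      rw [hu k hvP]
    · obtain ⟨i, hi, hu⟩ := he e
      refine ⟨q i, ⟨(hmem _).2 ⟨i, rfl⟩, hi⟩, ?_⟩
      rintro P ⟨hP, heP⟩
      obtain ⟨k, rfl⟩ := (hmem _).1 hP
      rw [hu k heP]
    · obtain ⟨k, rfl⟩ := (hmem _).1 hP
      exact hs k e
    · exact fun i k h => hq (congrArg Subtype.val h)
    · rintro ⟨P, hP⟩
      obtain ⟨k, rfl⟩ := (hmem _).1 hP
      exact ⟨k, rfl⟩

end Families

/-! ### Comparison of coefficients -/

theorem egfCoeff_tDeriv_T_pow (n : ℕ) (l : EdgeSize →₀ ℕ) (j : ℕ) :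
    egfCoeff (tDeriv T ^ j) n l =
      Nat.card (VertexRootedHypertreeFamily (Fin n) (fun e : EdgeLabel l => e.1) j) := by
  classical
  have := Fintype.ofFinite (EdgeLabel l)
  have h1 : Finsupp.optionElim n l =
      colorCount (labelColor (V := Fin n) fun e : EdgeLabel l => e.1) := by
    rw [colorCount_labelColor, Nat.card_fin, colorCount_edgeLabel]
  have h2 : tDeriv T ^ j = ∏ _i : Fin j, tDeriv T := by simp
  rw [egfCoeff_eq_expCoeff, h1, h2, expCoeff_prod, card_vertexRootedHypertreeFamily,
    Nat.card_sigma, Nat.cast_sum]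
  refine Finset.sum_congr rfl fun h _ => ?_
  rw [Nat.card_pi, Nat.cast_prod]
  refine Finset.prod_congr rfl fun i _ => ?_
  -- The factor produced by `t ∂/∂t` is the number of vertices in the fibre, that is, the number of
  -- choices of a root.
  rw [fiberCount_labelColor, ← egfCoeff_eq_expCoeff, egfCoeff_tDeriv,
    egfCoeff_T_eq_ncard_hypertrees, ← card_sizedHypertree, Nat.card_prod, Nat.cast_mul, mul_comm]

theorem egfCoeff_smul_tDeriv_T_pow (n : ℕ) (l : EdgeSize →₀ ℕ) (j : ℕ) :
    egfCoeff ((1 / (j ! : ℚ)) • tDeriv T ^ j) n l = Nat.card (VertexRootedHypertreeSet n l j) := by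
  have : (j ! : ℚ) ≠ 0 := Nat.cast_ne_zero.2 (Nat.factorial_ne_zero _)
  rw [egfCoeff_smul, egfCoeff_tDeriv_T_pow, card_family_eq_factorial_mul]
  push_cast
  field_simp

theorem pderiv_uVar_T (j : ℕ) (hj : 2 ≤ j) :
    MvPowerSeries.pderiv ℚ (uVar j hj) T = (1 / (j ! : ℚ)) • tDeriv T ^ j := by
  refine series_ext fun n l => ?_
  obtain ⟨Φ, -⟩ := exists_equiv_isRemovalOfRootEdge hj n l
  rw [egfCoeff_pderiv_T, egfCoeff_smul_tDeriv_T_pow, Nat.card_congr Φ]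

end HypertreeEGF

theorem mainTheorem4 :
    -- every term of `C_n` has magnitude at least `n - 1`, so `T` collects the leading terms of `C`
    (∀ (n : ℕ) (l : EdgeSize →₀ ℕ), egfCoeff C n l ≠ 0 → n ≤ magnitude l + 1) ∧
    -- `T` is the exponential generating function of labeled hypertrees
    (∀ (n : ℕ) (l : EdgeSize →₀ ℕ), egfCoeff T n l = (Hypertrees n l).ncard) ∧
    -- the two recursions
    (MvPowerSeries.pderiv ℚ (uVar 2 le_rfl) T = (1 / 2 : ℚ) • tDeriv T ^ 2) ∧
    (∀ (j : ℕ) (hj : 3 ≤ j),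
      MvPowerSeries.pderiv ℚ (uVar j (by omega)) T =
        (1 / (j : ℚ)) • (tDeriv T * MvPowerSeries.pderiv ℚ (uVar (j - 1) (by omega)) T)) ∧
    -- the differential equation
    (∀ (j : ℕ) (hj : 2 ≤ j),
      MvPowerSeries.pderiv ℚ (uVar j hj) T = (1 / (j ! : ℚ)) • tDeriv T ^ j) ∧
    -- what its two sides count, and the bijection between the objects counted
    (∀ (j : ℕ) (hj : 2 ≤ j) (n : ℕ) (l : EdgeSize →₀ ℕ),
      Finite (EdgeRootedHypertree n l j) ∧
      Finite (VertexRootedHypertreeSet n l j) ∧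
      egfCoeff (MvPowerSeries.pderiv ℚ (uVar j hj) T) n l = Nat.card (EdgeRootedHypertree n l j) ∧
      egfCoeff ((1 / (j ! : ℚ)) • tDeriv T ^ j) n l = Nat.card (VertexRootedHypertreeSet n l j) ∧
      ∃ Φ : EdgeRootedHypertree n l j ≃ VertexRootedHypertreeSet n l j,
        ∀ H, IsRemovalOfRootEdge H (Φ H)) := by
  refine ⟨fun n l h => ?_, egfCoeff_T_eq_ncard_hypertrees, ?_, fun j hj => ?_, pderiv_uVar_T,
    fun j hj n l => ⟨inferInstance, inferInstance, egfCoeff_pderiv_T j hj n l,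
      egfCoeff_smul_tDeriv_T_pow n l j, exists_equiv_isRemovalOfRootEdge hj n l⟩⟩
  · rw [egfCoeff_C, Nat.cast_ne_zero] at h
    obtain ⟨H, hH⟩ := Set.nonempty_of_ncard_ne_zero h
    exact le_magnitude_of_mem_connectedHypergraphs hH
  · simpa using pderiv_uVar_T 2 le_rfl
  · obtain ⟨k, rfl⟩ : ∃ k, j = k + 1 := ⟨j - 1, by omega⟩
    have h : MvPowerSeries.pderiv ℚ (uVar (k + 1 - 1) (by omega)) T =
        (1 / (k ! : ℚ)) • tDeriv T ^ k := pderiv_uVar_T k (by omega)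
    rw [h, pderiv_uVar_T, mul_smul_comm, smul_smul, pow_succ', Nat.factorial_succ, Nat.cast_mul,
      one_div_mul_one_div]
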